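/- **Dicots.** A dicot consists of a finite vertex set $V$ and two simple graphs on $V$, one of solid and one of dashed edges, whose union is bipartite (two vertices may be joined by both a solid and a dashed edge). Vertices $v$, solid edges $(v,v')$ and dashed edges $(v,v')$ carry positive real weights $x(v)$, $a(v,v')=a(v',v)$ and $b(v,v')=b(v',v)$, and every solid edge is given a direction. A monopole-dimer configuration is a set of pairwise vertex-disjoint directed loops of even length, each containing an even number of dashed edges; a loop of length $2$ is a doubled edge (traversed back and forth), and the two directions of a loop of length at least $4$ count as different. Vertices on no loop are isolated. The weight of a loop is minus the product over its steps $u\to v$ of $a(u,v)$ for a solid edge directed from $u$ to $v$, of $-a(u,v)$ for a solid edge directed from $v$ to $u$, and of $i\,b(u,v)$ for a dashed edge. The weight of a configuration is the product of the weights of its loops and of the weights $x(w)$ of its isolated vertices $w$. The partition function is the sum of the weights of all configurations. A bipartite oriented weighted graph is regarded as a dicot without dashed edges. **Grids.** Let $m,n$ be positive integers and $x,a,b>0$ real. Let $Q=Q_{2m,2n}$ be the grid graph with vertices $(j,k)$, $1\le j\le 2m$, $1\le k\le 2n$, vertex-weights $x$, edges $(j,k)(j+1,k)$ of weight $a$,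 and edges $(j,k)(j,k+1)$ of weight $b$. Direct $(j,k)\to(j+1,k)$ if $k$ is even and the other way if $k$ is odd, and $(j,k)\to(j,k+1)$ if $k<n$ and the other way if $k\ge n$. Let $\pi(j,k)=(2m+1-j,2n+1-k)$ be the rotation by $180^\circ$. It is a fixed-point free involution that preserves the weighted graph $Q$. Put $P_1=\{(j,k): k\le n\}$ and $P_2=\{(j,k): k>n\}$. The partition $\{P_1,P_2\}$ is adapted to $\pi$: $\pi$ exchanges $P_1$ and $P_2$; no $v$ is adjacent to $\pi(v)$; $\pi$ preserves the directions of the edges inside $P_1$; and for $u,v\in P_1$ the edges $(u,\pi(v))$ and $(v,\pi(u))$, if present, are both directed from $P_1$ to $P_2$ or both from $P_2$ to $P_1$. The quotient dicot $\tilde{\mathcal Q}_{2m,n}=Q_{2m,2n}/\pi$ has vertex set $P_1$; its solid edges are the edges of $Q$ inside $P_1$, with their weights and directions; and $u,v\in P_1$ are joined by a dashed edge exactly when $(u,\pi(v))$ is an edge of $Q$, whose weight the dashed edge inherits. Vertex-weights are inherited from $Q$. **Statement.** The partition function of the monopole-dimer model on $\tilde{\mathcal Q}_{2m,n}$ is $$\mathcal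 Z(\tilde{\mathcal Q}_{2m,n})=\prod_{j=1}^{m}\prod_{k=1}^{n}\left(x^2+4a^2\cos^2\frac{j\pi}{2m+1}+4b^2\cos^2\frac{k\pi}{2n+1}\right),$$ and it is the (positive) square root of the partition function $Z(Q_{2m,2n})$ of the monopole-dimer model on the grid: $Z(Q_{2m,2n})=\mathcal Z(\tilde{\mathcal Q}_{2m,n})^2$. -/

import Mathlib

open scoped BigOperators

noncomputable section

namespace MonopoleDimer

/-- A simple graph on `V` with positive real vertex- and edge-weights and a prescribed
orientation: `dir u v` means that the edge between `u` and `v` points from `u` to `v`. -/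
structure WeightedGraph (V : Type*) where
  graph : SimpleGraph V
  vertexWeight : V → ℝ
  edgeWeight : V → V → ℝ
  dir : V → V → Prop
  vertexWeight_pos : ∀ v, 0 < vertexWeight v
  edgeWeight_pos : ∀ u v, graph.Adj u v → 0 < edgeWeight u v
  edgeWeight_comm : ∀ u v, graph.Adj u v → edgeWeight u v = edgeWeight v u
  adj_of_dir : ∀ u v, dir u v → graph.Adj u v
  dir_xor : ∀ u v, graph.Adj u v → Xor (dir u v) (dir v u)

/-- A dicot `[V, A, B]`: two simple graphs on `V`, of solid and of dashed edges, whose union is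
bipartite, with positive real weights on vertices, solid edges and dashed edges, and an orientation
`dir` of the solid edges. -/
structure Dicot (V : Type*) where
  solid : SimpleGraph V
  dashed : SimpleGraph V
  bipartite : (solid ⊔ dashed).IsBipartite
  vertexWeight : V → ℝ
  solidWeight : V → V → ℝ
  dashedWeight : V → V → ℝ
  dir : V → V → Prop
  vertexWeight_pos : ∀ v, 0 < vertexWeight v
  solidWeight_pos : ∀ u v, solid.Adj u v → 0 < solidWeight u v
  solidWeight_comm : ∀ u v, solid.Adj u v → solidWeight u v = solidWeight v u
  dashedWeight_pos : ∀ u v, dashed.Adj u v → 0 < dashedWeight u v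
  dashedWeight_comm : ∀ u v, dashed.Adj u v → dashedWeight u v = dashedWeight v u
  adj_of_dir : ∀ u v, dir u v → solid.Adj u v
  dir_xor : ∀ u v, solid.Adj u v → Xor (dir u v) (dir v u)

namespace Dicot

variable {V : Type*} [Fintype V] [DecidableEq V]

/-- The monopole-dimer configurations of a dicot. A family of vertex-disjoint directed loops is
encoded by the permutation `σ` that moves each vertex of a loop to the next one along that loop
and fixes the isolated vertices, so the loops are the nontrivial cycles of `σ` and a doubled edge
is a 2-cycle. As two vertices may be joined by a solid and by a dashed edge, the loops are only
determined together with the set `D` of those vertices `v` for which the step `v → σ v` is along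
the dashed edge (all other steps are along solid edges). Every loop has even length and an even
number of dashed edges. -/
structure IsConfiguration (G : Dicot V) (σ : Equiv.Perm V) (D : Finset V) : Prop where
  dashed_step : ∀ v ∈ D, G.dashed.Adj v (σ v)
  solid_step : ∀ v ∈ σ.support, v ∉ D → G.solid.Adj v (σ v)
  even_length : ∀ c ∈ σ.cycleFactorsFinset, Even c.support.card
  even_dashed : ∀ c ∈ σ.cycleFactorsFinset, Even (c.support ∩ D).card

open Classical in
/-- The set of monopole-dimer configurations. -/
def configurations (G : Dicot V) : Finset (Equiv.Perm V × Finset V) :=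
  Finset.univ.filter fun C => G.IsConfiguration C.1 C.2

open Classical in
/-- The factor of the step from `u` to `v` along the solid edge: its weight, with a minus sign
if the step goes against the orientation. -/
def solidFactor (G : Dicot V) (u v : V) : ℂ :=
  if G.dir u v then (G.solidWeight u v : ℂ) else -(G.solidWeight u v : ℂ)

/-- The weight of the loop given by the cycle `c` with dashed steps exactly at the vertices
in `D`. -/
def loopWeight (G : Dicot V) (c : Equiv.Perm V) (D : Finset V) : ℂ :=
  -∏ v ∈ c.support,
    if v ∈ D then Complex.I * (G.dashedWeight v (c v) : ℂ) else G.solidFactor v (c v)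

/-- The weight of a configuration: the product of the weights of the loops and of the weights of
the isolated vertices. -/
def weight (G : Dicot V) (C : Equiv.Perm V × Finset V) : ℂ :=
  (∏ c ∈ C.1.cycleFactorsFinset, G.loopWeight c C.2) *
    ∏ v ∈ C.1.supportᶜ, (G.vertexWeight v : ℂ)

/-- The partition function of the monopole-dimer model on an oriented dicot. -/
def partitionFunction (G : Dicot V) : ℂ :=
  ∑ C ∈ G.configurations, G.weight C

end Dicot

namespace WeightedGraph

variable {V : Type*}

/-- A bipartite graph is a dicot without dashed edges. -/
def toDicot (G : WeightedGraph V) (h : G.graph.IsBipartite) : Dicot V where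
  solid := G.graph
  dashed := ⊥
  bipartite := by simpa using h
  vertexWeight := G.vertexWeight
  solidWeight := G.edgeWeight
  dashedWeight := fun _ _ => 0
  dir := G.dir
  vertexWeight_pos := G.vertexWeight_pos
  solidWeight_pos := G.edgeWeight_pos
  solidWeight_comm := G.edgeWeight_comm
  dashedWeight_pos := fun _ _ h => absurd h (by simp)
  dashedWeight_comm := fun _ _ _ => rfl
  adj_of_dir := G.adj_of_dir
  dir_xor := G.dir_xor

/-- The partition function of the monopole-dimer model on a bipartite oriented graph. -/
def partitionFunction [Fintype V] [DecidableEq V] (G : WeightedGraph V)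
    (h : G.graph.IsBipartite) : ℂ :=
  (G.toDicot h).partitionFunction

/-- `π` is an automorphism of the weighted graph `G` and a fixed-point free involution. -/
structure IsFreeInvolution (G : WeightedGraph V) (π : Equiv.Perm V) : Prop where
  adj_iff : ∀ u v, G.graph.Adj (π u) (π v) ↔ G.graph.Adj u v
  vertexWeight_eq : ∀ v, G.vertexWeight (π v) = G.vertexWeight v
  edgeWeight_eq : ∀ u v, G.graph.Adj u v → G.edgeWeight (π u) (π v) = G.edgeWeight u v
  involutive : ∀ v, π (π v) = v
  fixedPointFree : ∀ v, π v ≠ v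

/-- The partition `{P₁, P₂}` of the vertex set is adapted to the involution `π`. -/
structure IsAdapted [Fintype V] [DecidableEq V] (G : WeightedGraph V) (π : Equiv.Perm V)
    (P₁ P₂ : Finset V) : Prop where
  disjoint : Disjoint P₁ P₂
  union_eq : P₁ ∪ P₂ = Finset.univ
  card_eq : P₁.card = P₂.card
  mem_iff : ∀ v, v ∈ P₁ ↔ π v ∈ P₂
  not_adj : ∀ v ∈ P₁, ¬ G.graph.Adj v (π v)
  dir_inside : ∀ u ∈ P₁, ∀ v ∈ P₁, G.graph.Adj u v → (G.dir u v ↔ G.dir (π u) (π v))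
  dir_across : ∀ u ∈ P₁, ∀ v ∈ P₁, G.graph.Adj u (π v) →
    (G.dir u (π v) ∧ G.dir v (π u)) ∨ (G.dir (π v) u ∧ G.dir (π u) v)

theorem IsFreeInvolution.adj_swap {G : WeightedGraph V} {π : Equiv.Perm V}
    (hπ : G.IsFreeInvolution π) {u v : V} (h : G.graph.Adj u (π v)) : G.graph.Adj v (π u) := by
  have h' := (hπ.adj_iff _ _).2 h
  rw [hπ.involutive] at h'
  exact h'.symm

theorem IsFreeInvolution.edgeWeight_swap {G : WeightedGraph V} {π : Equiv.Perm V}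
    (hπ : G.IsFreeInvolution π) {u v : V} (h : G.graph.Adj u (π v)) :
    G.edgeWeight u (π v) = G.edgeWeight v (π u) := by
  rw [← hπ.edgeWeight_eq _ _ h, hπ.involutive]
  exact G.edgeWeight_comm _ _ (hπ.adj_swap h).symm

section Quotient

variable [Fintype V] [DecidableEq V] (G : WeightedGraph V) {π : Equiv.Perm V} {P₁ P₂ : Finset V}

/-- The solid edges of the quotient dicot: the edges of `G` inside `P₁`. -/
def quotientSolid (P₁ : Finset V) : SimpleGraph P₁ :=
  G.graph.comap fun v : P₁ => (v : V)

/-- The dashed edges of the quotient dicot: `u, v ∈ P₁` are joined by a dashed edge when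
`(u, π v)` is an edge of `G`. -/
def quotientDashed (hπ : G.IsFreeInvolution π) (hP : G.IsAdapted π P₁ P₂) : SimpleGraph P₁ where
  Adj u v := G.graph.Adj u (π v)
  symm := ⟨fun _ _ h => hπ.adj_swap h⟩
  loopless := ⟨fun u h => hP.not_adj u u.2 h⟩

/-- The quotient dicot `G/π` on the vertex set `P₁`, with the weights and the orientation that it
inherits from `G`. -/
def quotientDicot (hπ : G.IsFreeInvolution π) (hP : G.IsAdapted π P₁ P₂)
    (hbip : (G.quotientSolid P₁ ⊔ G.quotientDashed hπ hP).IsBipartite) : Dicot P₁ where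
  solid := G.quotientSolid P₁
  dashed := G.quotientDashed hπ hP
  bipartite := hbip
  vertexWeight v := G.vertexWeight v
  solidWeight u v := G.edgeWeight u v
  dashedWeight u v := G.edgeWeight u (π v)
  dir u v := G.dir u v
  vertexWeight_pos v := G.vertexWeight_pos v
  solidWeight_pos u v h := G.edgeWeight_pos u v h
  solidWeight_comm u v h := G.edgeWeight_comm u v h
  dashedWeight_pos u v h := G.edgeWeight_pos u (π v) h
  dashedWeight_comm _ _ h := hπ.edgeWeight_swap h
  adj_of_dir u v h := G.adj_of_dir u v h
  dir_xor u v h := G.dir_xor u v h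

end Quotient

end WeightedGraph

section Grid

/-- The vertices of the `2m × 2n` grid. The pair of indices `(p.1, p.2)`, counted from `0`,
stands for the vertex `(j, k) = (p.1 + 1, p.2 + 1)` with `1 ≤ j ≤ 2m` and `1 ≤ k ≤ 2n`. -/
abbrev GridVertex (m n : ℕ) : Type := Fin (2 * m) × Fin (2 * n)

/-- The orientation of the grid: `(j, k) → (j + 1, k)` if `k` is even and the other way if `k` is
odd, and `(j, k) → (j, k + 1)` if `k < n` and the other way if `k ≥ n`. -/
def gridDir (m n : ℕ) (p q : GridVertex m n) : Prop :=
  (p.2 = q.2 ∧ ((p.1.val + 1 = q.1.val ∧ Even (p.2.val + 1)) ∨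
      (q.1.val + 1 = p.1.val ∧ Odd (p.2.val + 1)))) ∨
    (p.1 = q.1 ∧ ((p.2.val + 1 = q.2.val ∧ p.2.val + 1 < n) ∨
      (q.2.val + 1 = p.2.val ∧ n ≤ q.2.val + 1)))

/-- The `2m × 2n` rectangular grid `Q_{2m,2n}` with all vertex-weights `x`, horizontal edge-weights
`a`, vertical edge-weights `b`, and the orientation `gridDir`. -/
def grid (m n : ℕ) {x a b : ℝ} (hx : 0 < x) (ha : 0 < a) (hb : 0 < b) :
    WeightedGraph (GridVertex m n) where
  graph := (SimpleGraph.pathGraph (2 * m)).boxProd (SimpleGraph.pathGraph (2 * n))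
  vertexWeight _ := x
  edgeWeight p q := if p.2 = q.2 then a else b
  dir := gridDir m n
  vertexWeight_pos _ := hx
  edgeWeight_pos p q _ := by split_ifs <;> assumption
  edgeWeight_comm p q _ := by simp only [eq_comm]
  adj_of_dir p q h := by
    simp only [SimpleGraph.boxProd_adj, SimpleGraph.pathGraph_adj]
    unfold gridDir at h
    tauto
  dir_xor p q h := by
    obtain ⟨⟨p1, hp1⟩, ⟨p2, hp2⟩⟩ := p
    obtain ⟨⟨q1, hq1⟩, ⟨q2, hq2⟩⟩ := q
    simp only [SimpleGraph.boxProd_adj, SimpleGraph.pathGraph_adj, Fin.mk.injEq] at h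
    simp only [gridDir, xor_def, Fin.mk.injEq, Nat.even_iff, Nat.odd_iff]
    rcases h with ⟨h | h, rfl⟩ | ⟨h | h, rfl⟩
    · rcases Nat.mod_two_eq_zero_or_one (p2 + 1) with h2 | h2 <;> (simp [h2]; omega)
    · rcases Nat.mod_two_eq_zero_or_one (p2 + 1) with h2 | h2 <;> (simp [h2]; omega)
    · rcases Nat.lt_or_ge (p2 + 1) n with h2 | h2 <;> (simp; omega)
    · rcases Nat.lt_or_ge (q2 + 1) n with h2 | h2 <;> (simp; omega)

/-- The rotation by 180 degrees, `(j, k) ↦ (2m + 1 - j, 2n + 1 - k)`. -/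
def gridRotation (m n : ℕ) : Equiv.Perm (GridVertex m n) :=
  Equiv.prodCongr Fin.revPerm Fin.revPerm

/-- The half `P₁ = {(j, k) | k ≤ n}` of the grid. -/
def gridLower (m n : ℕ) : Finset (GridVertex m n) :=
  Finset.univ.filter fun p => p.2.val + 1 ≤ n

/-- The half `P₂ = {(j, k) | n + 1 ≤ k}` of the grid. -/
def gridUpper (m n : ℕ) : Finset (GridVertex m n) :=
  Finset.univ.filter fun p => n + 1 ≤ p.2.val + 1

variable (m n : ℕ) {x a b : ℝ} (hx : 0 < x) (ha : 0 < a) (hb : 0 < b)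

theorem grid_bipartite : (grid m n hx ha hb).graph.IsBipartite := by
  refine ⟨SimpleGraph.Coloring.mk (fun p => ⟨(p.1.val + p.2.val) % 2, by omega⟩) ?_⟩
  rintro ⟨⟨p1, hp1⟩, ⟨p2, hp2⟩⟩ ⟨⟨q1, hq1⟩, ⟨q2, hq2⟩⟩ h
  simp only [grid, SimpleGraph.boxProd_adj, SimpleGraph.pathGraph_adj, Fin.mk.injEq] at h
  simp only [ne_eq, Fin.mk.injEq]
  omega

theorem gridRotation_isFreeInvolution :
    (grid m n hx ha hb).IsFreeInvolution (gridRotation m n) where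
  adj_iff := by
    rintro ⟨⟨p1, hp1⟩, ⟨p2, hp2⟩⟩ ⟨⟨q1, hq1⟩, ⟨q2, hq2⟩⟩
    simp only [grid, gridRotation, Equiv.prodCongr_apply, Prod.map, Fin.revPerm_apply,
      SimpleGraph.boxProd_adj, SimpleGraph.pathGraph_adj, Fin.val_rev, Fin.ext_iff]
    omega
  vertexWeight_eq _ := rfl
  edgeWeight_eq p q _ := by
    simp [grid, gridRotation]
  involutive p := by
    ext <;> simp [gridRotation]
  fixedPointFree := by
    rintro ⟨⟨p1, hp1⟩, ⟨p2, hp2⟩⟩ h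
    simp only [gridRotation, Equiv.prodCongr_apply, Prod.map, Fin.revPerm_apply,
      Prod.mk.injEq, Fin.ext_iff, Fin.val_rev] at h
    omega

theorem grid_isAdapted :
    (grid m n hx ha hb).IsAdapted (gridRotation m n) (gridLower m n) (gridUpper m n) := by
  have hmem : ∀ v, v ∈ gridLower m n ↔ gridRotation m n v ∈ gridUpper m n := by
    rintro ⟨⟨p1, hp1⟩, ⟨p2, hp2⟩⟩
    simp only [gridLower, gridUpper, gridRotation, Finset.mem_filter, Finset.mem_univ, true_and,
      Equiv.prodCongr_apply, Prod.map, Fin.revPerm_apply, Fin.val_rev]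
    omega
  refine ⟨?_, ?_, ?_, hmem, ?_, ?_, ?_⟩
  · rw [Finset.disjoint_left]
    intro p
    simp only [gridLower, gridUpper, Finset.mem_filter, Finset.mem_univ, true_and]
    omega
  · ext p
    simp only [gridLower, gridUpper, Finset.mem_union, Finset.mem_filter, Finset.mem_univ,
      true_and, iff_true]
    omega
  · refine Finset.card_bij (fun v _ => gridRotation m n v) (fun v hv => (hmem v).1 hv)
      (fun u _ v _ h => (gridRotation m n).injective h) (fun w hw => ?_)
    have hw' : gridRotation m n (gridRotation m n w) = w :=
      (gridRotation_isFreeInvolution m n one_pos one_pos one_pos).involutive w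
    exact ⟨gridRotation m n w, (hmem _).2 (hw'.symm ▸ hw), hw'⟩
  · rintro ⟨⟨p1, hp1⟩, ⟨p2, hp2⟩⟩ _ h
    simp only [grid, gridRotation, Equiv.prodCongr_apply, Prod.map, Fin.revPerm_apply,
      SimpleGraph.boxProd_adj, SimpleGraph.pathGraph_adj, Fin.val_rev, Fin.ext_iff] at h
    omega
  · rintro ⟨⟨p1, hp1⟩, ⟨p2, hp2⟩⟩ hu ⟨⟨q1, hq1⟩, ⟨q2, hq2⟩⟩ hv _
    simp only [gridLower, Finset.mem_filter, Finset.mem_univ, true_and] at hu hv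
    simp only [grid, gridDir, gridRotation, Equiv.prodCongr_apply, Prod.map, Fin.revPerm_apply,
      Fin.val_rev, Fin.ext_iff, Nat.even_iff, Nat.odd_iff]
    have h1 : (2 * m - (p1 + 1) = 2 * m - (q1 + 1)) ↔ p1 = q1 := by omega
    have h2 : (2 * n - (p2 + 1) = 2 * n - (q2 + 1)) ↔ p2 = q2 := by omega
    have h3 : (2 * m - (p1 + 1) + 1 = 2 * m - (q1 + 1)) ↔ q1 + 1 = p1 := by omega
    have h4 : (2 * m - (q1 + 1) + 1 = 2 * m - (p1 + 1)) ↔ p1 + 1 = q1 := by omega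
    have h5 : (2 * n - (p2 + 1) + 1) % 2 = p2 % 2 := by omega
    have h6 : (2 * n - (p2 + 1) + 1 = 2 * n - (q2 + 1)) ↔ q2 + 1 = p2 := by omega
    have h7 : (2 * n - (q2 + 1) + 1 = 2 * n - (p2 + 1)) ↔ p2 + 1 = q2 := by omega
    have h8 : ¬ (2 * n - (p2 + 1) + 1 < n) := by omega
    have h9 : n ≤ 2 * n - (q2 + 1) + 1 := by omega
    have h10 : (p2 % 2 = 0) ↔ (p2 + 1) % 2 = 1 := by omega
    have h11 : (p2 % 2 = 1) ↔ (p2 + 1) % 2 = 0 := by omega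
    have h12 : p2 + 1 = q2 → p2 + 1 < n := by omega
    have h13 : q2 + 1 = p2 → ¬ n ≤ q2 + 1 := by omega
    rw [h1, h2, h3, h4, h5, h6, h7, h10, h11]
    clear h1 h2 h3 h4 h5 h6 h7 h10 h11
    constructor
    · rintro (⟨e, ⟨e1, e2⟩ | ⟨e1, e2⟩⟩ | ⟨e, ⟨e1, e2⟩ | ⟨e1, e2⟩⟩)
      · exact Or.inl ⟨e, Or.inr ⟨e1, e2⟩⟩
      · exact Or.inl ⟨e, Or.inl ⟨e1, e2⟩⟩
      · exact Or.inr ⟨e, Or.inr ⟨e1, h9⟩⟩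
      · exact absurd e2 (h13 e1)
    · rintro (⟨e, ⟨e1, e2⟩ | ⟨e1, e2⟩⟩ | ⟨e, ⟨e1, e2⟩ | ⟨e1, e2⟩⟩)
      · exact Or.inl ⟨e, Or.inr ⟨e1, e2⟩⟩
      · exact Or.inl ⟨e, Or.inl ⟨e1, e2⟩⟩
      · exact absurd e2 h8
      · exact Or.inr ⟨e, Or.inl ⟨e1, h12 e1⟩⟩
  · rintro ⟨⟨p1, hp1⟩, ⟨p2, hp2⟩⟩ hu ⟨⟨q1, hq1⟩, ⟨q2, hq2⟩⟩ hv h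
    simp only [gridLower, Finset.mem_filter, Finset.mem_univ, true_and] at hu hv
    simp only [grid, gridRotation, Equiv.prodCongr_apply, Prod.map, Fin.revPerm_apply,
      SimpleGraph.boxProd_adj, SimpleGraph.pathGraph_adj, Fin.val_rev, Fin.ext_iff] at h
    have h1 : p1 = 2 * m - (q1 + 1) := by omega
    have h2 : p2 + 1 = n := by omega
    have h3 : q2 + 1 = n := by omega
    simp only [grid, gridDir, gridRotation, Equiv.prodCongr_apply, Prod.map, Fin.revPerm_apply,
      Fin.val_rev, Fin.ext_iff]
    exact Or.inr ⟨Or.inr ⟨by omega, Or.inr ⟨by omega, by omega⟩⟩,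
      Or.inr ⟨by omega, Or.inr ⟨by omega, by omega⟩⟩⟩

theorem gridQuotient_bipartite :
    ((grid m n hx ha hb).quotientSolid (gridLower m n) ⊔
      (grid m n hx ha hb).quotientDashed (gridRotation_isFreeInvolution m n hx ha hb)
        (grid_isAdapted m n hx ha hb)).IsBipartite := by
  refine ⟨SimpleGraph.Coloring.mk (fun p => ⟨(p.1.1.val + p.1.2.val) % 2, by omega⟩) ?_⟩
  rintro ⟨⟨⟨p1, hp1⟩, ⟨p2, hp2⟩⟩, hp⟩ ⟨⟨⟨q1, hq1⟩, ⟨q2, hq2⟩⟩, hq⟩ h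
  simp only [gridLower, Finset.mem_filter, Finset.mem_univ, true_and] at hp hq
  simp only [SimpleGraph.sup_adj, WeightedGraph.quotientSolid, SimpleGraph.comap_adj,
    WeightedGraph.quotientDashed, grid, gridRotation, Equiv.prodCongr_apply, Prod.map,
    Fin.revPerm_apply, SimpleGraph.boxProd_adj, SimpleGraph.pathGraph_adj, Fin.val_rev,
    Fin.ext_iff] at h
  simp only [ne_eq, Fin.mk.injEq]
  omega

/-- The quotient dicot of the grid `Q_{2m,2n}` under the rotation by 180 degrees. -/
def gridQuotient : Dicot (gridLower m n) :=
  (grid m n hx ha hb).quotientDicot (gridRotation_isFreeInvolution m n hx ha hb)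
    (grid_isAdapted m n hx ha hb) (gridQuotient_bipartite m n hx ha hb)

end Grid

end MonopoleDimer

end

/-!
The partition function of a dicot is the determinant of the matrix `K` with the vertex-weights on
the diagonal, `±a(u, v)` for a solid and `i b(u, v)` for a dashed edge
(`Dicot.partitionFunction_eq_det`). In the expansion of `det K` over pairs of a permutation and a set
of dashed steps, a cycle of odd length cannot contribute as the dicot is bipartite, and the minus sign of
each loop is the sign of an even cycle. A loop with an odd number of dashed steps also has an odd
number of solid steps, so its weight changes sign when the loop is reversed, and these terms cancel
in pairs (`Dicot.sum_term_oddVertices`).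

Identify the upper half of the grid with the lower half by the rotation. As all edges between the
halves point downwards, the matrix of the grid has the blocks `A, iC, -iC, A`, where `A + C` is the
matrix of the quotient. Its determinant is `det (A + C) * det (A - C)`, and the two factors agree: a
transposition followed by a change of sign on one colour class turns `A - C` into `A + C`. This gives
the statement on the square (`WeightedGraph.det_toDicot_eq_sq`).

Up to signs, the matrix of the grid with vertex-weight `t` is `t + a T ⊗ F + b 1 ⊗ S`, where `T` and
`S` belong to oriented paths and `F` is diagonal with alternating signs. The vectors with the entries
`i ^ k * sin (k θ)` diagonalize `T` and `S`, with eigenvalues `2 i cos θ`, and `F` exchanges those for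
`θ` and `π - θ`. What is left are `2 × 2` determinants, and the determinant of the grid is the square
of the product in question (`grid_det`). Therefore `det (t + N)`, where `N` is the matrix of the
quotient without its diagonal, and the product have the same square for all `t`. Both are monic
polynomials in `t`, so they are equal (`det_diagonal_add_eq_prod`).
-/

noncomputable section

namespace MonopoleDimer

/-! ### Reversing one loop of a permutation -/

section LoopReversal

open Equiv Equiv.Perm

variable {V : Type*} [Fintype V] [DecidableEq V]

omit [Fintype V] [DecidableEq V] in
theorem apply_inv_apply (c : Perm V) (v : V) : c (c⁻¹ v) = v := c.apply_symm_apply v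

theorem inv_apply_mem_support {c : Perm V} {v : V} : c⁻¹ v ∈ c.support ↔ v ∈ c.support := by
  rw [← Perm.apply_mem_support, apply_inv_apply]

/-- The pair `(σ, D)` with the cycle `c` of `σ` traversed backwards. The step `v → c v` becomes the
step `c v → v`, so the marked starting points on `c` are moved along `c`. -/
def reverseLoop (c : Perm V) (C : Perm V × Finset V) : Perm V × Finset V :=
  (C.1 * c⁻¹ * c⁻¹, C.2.map c.toEmbedding)

omit [Fintype V] [DecidableEq V] in
theorem apply_mem_reverseLoop_iff (c : Perm V) (C : Perm V × Finset V) (v : V) :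
    c v ∈ (reverseLoop c C).2 ↔ v ∈ C.2 := by
  simp [reverseLoop]

omit [Fintype V] [DecidableEq V] in
theorem reverseLoop_reverseLoop (c : Perm V) (C : Perm V × Finset V) :
    reverseLoop c⁻¹ (reverseLoop c C) = C := by
  ext v
  · simp [reverseLoop]
  · rw [← apply_mem_reverseLoop_iff c C v, ← apply_mem_reverseLoop_iff c⁻¹ _ (c v)]
    simp

theorem reverseLoop_apply_of_mem {c : Perm V} {C : Perm V × Finset V}
    (hc : c ∈ C.1.cycleFactorsFinset) {v : V} (hv : v ∈ c.support) :
    (reverseLoop c C).1 (c v) = v := by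
  have h := (mem_cycleFactorsFinset_iff.1 hc).2 (c⁻¹ v) (inv_apply_mem_support.2 hv)
  rw [apply_inv_apply] at h
  change C.1 (c⁻¹ (c.symm (c v))) = v
  rw [c.symm_apply_apply, ← h]

theorem reverseLoop_apply_of_notMem {c : Perm V} {C : Perm V × Finset V} {v : V}
    (hv : v ∉ c.support) : (reverseLoop c C).1 v = C.1 v := by
  have h : c⁻¹ v = v := by
    rw [Perm.inv_eq_iff_eq]; exact (notMem_support.1 hv).symm
  rw [reverseLoop, Perm.mul_apply, Perm.mul_apply, h, h]

theorem inv_mem_cycleFactorsFinset_reverseLoop {c : Perm V} {C : Perm V × Finset V}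
    (hc : c ∈ C.1.cycleFactorsFinset) : c⁻¹ ∈ (reverseLoop c C).1.cycleFactorsFinset := by
  refine mem_cycleFactorsFinset_iff.2 ⟨(mem_cycleFactorsFinset_iff.1 hc).1.inv, fun v hv => ?_⟩
  have h := reverseLoop_apply_of_mem hc (v := c⁻¹ v)
    (inv_apply_mem_support.2 (by simpa using hv))
  rw [apply_inv_apply] at h
  exact h.symm

theorem mem_cycleFactorsFinset_reverseLoop {c d : Perm V} {C : Perm V × Finset V}
    (hd : d ∈ C.1.cycleFactorsFinset) (h : _root_.Disjoint d.support c.support) :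
    d ∈ (reverseLoop c C).1.cycleFactorsFinset := by
  obtain ⟨hd₁, hd₂⟩ := mem_cycleFactorsFinset_iff.1 hd
  refine mem_cycleFactorsFinset_iff.2 ⟨hd₁, fun v hv => ?_⟩
  rw [hd₂ v hv, reverseLoop_apply_of_notMem (Finset.disjoint_left.1 h hv)]

theorem card_support_inter_reverseLoop (c : Perm V) (C : Perm V × Finset V) :
    (c⁻¹.support ∩ (reverseLoop c C).2).card = (c.support ∩ C.2).card := by
  have h : c⁻¹.support = c.support.map c.toEmbedding := by
    ext v
    rw [support_inv, Finset.mem_map_equiv]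
    exact inv_apply_mem_support.symm
  rw [h, reverseLoop, ← Finset.map_inter, Finset.card_map]

theorem support_inter_reverseLoop {c d : Perm V} {C : Perm V × Finset V}
    (h : _root_.Disjoint d.support c.support) :
    d.support ∩ (reverseLoop c C).2 = d.support ∩ C.2 := by
  ext v
  simp only [Finset.mem_inter, and_congr_right_iff]
  intro hv
  have hcv : c v = v := notMem_support.1 (Finset.disjoint_left.1 h hv)
  conv_lhs => rw [← hcv]
  exact apply_mem_reverseLoop_iff c C v

open Classical in
/-- The vertices on the loops with an odd number of marked steps. -/
def oddVertices (C : Perm V × Finset V) : Finset V :=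
  Finset.univ.filter fun v =>
    ∃ c ∈ C.1.cycleFactorsFinset, v ∈ c.support ∧ Odd (c.support ∩ C.2).card

theorem mem_oddVertices {C : Perm V × Finset V} {v : V} : v ∈ oddVertices C ↔
    ∃ c ∈ C.1.cycleFactorsFinset, v ∈ c.support ∧ Odd (c.support ∩ C.2).card := by
  simp [oddVertices]

theorem oddVertices_reverseLoop {c : Perm V} {C : Perm V × Finset V}
    (hc : c ∈ C.1.cycleFactorsFinset) : oddVertices (reverseLoop c C) = oddVertices C := by
  have key : ∀ {c : Perm V} {C : Perm V × Finset V}, c ∈ C.1.cycleFactorsFinset →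
      oddVertices C ⊆ oddVertices (reverseLoop c C) := by
    intro c C hc v hv
    rw [mem_oddVertices] at hv ⊢
    obtain ⟨d, hd, hvd, hodd⟩ := hv
    rcases eq_or_ne d c with rfl | hdc
    · exact ⟨d⁻¹, inv_mem_cycleFactorsFinset_reverseLoop hc, by simpa using hvd,
        by rwa [card_support_inter_reverseLoop]⟩
    · have hdisj : _root_.Disjoint d.support c.support :=
        (cycleFactorsFinset_pairwise_disjoint _ hd hc hdc).disjoint_support
      exact ⟨d, mem_cycleFactorsFinset_reverseLoop hd hdisj, hvd,
        by rwa [support_inter_reverseLoop hdisj]⟩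
  refine Finset.Subset.antisymm ?_ (key hc)
  simpa only [reverseLoop_reverseLoop] using key (inv_mem_cycleFactorsFinset_reverseLoop hc)

/-- A loop of `C` with an odd number of marked steps. It is the one through a vertex that depends
on the set `oddVertices C` only, hence the same loop is selected again once it is reversed. -/
def oddLoop [Nonempty V] (C : Perm V × Finset V) : Perm V :=
  C.1.cycleOf (Classical.epsilon (· ∈ oddVertices C))

theorem oddLoop_spec [Nonempty V] {C : Perm V × Finset V} (h : (oddVertices C).Nonempty) :
    oddLoop C ∈ C.1.cycleFactorsFinset ∧
      Classical.epsilon (· ∈ oddVertices C) ∈ (oddLoop C).support ∧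
      Odd ((oddLoop C).support ∩ C.2).card := by
  have hv : Classical.epsilon (· ∈ oddVertices C) ∈ oddVertices C := Classical.epsilon_spec h
  obtain ⟨c, hc, hvc, hodd⟩ := mem_oddVertices.1 hv
  have hcc : oddLoop C = c := (cycle_is_cycleOf hvc hc).symm
  rw [hcc]
  exact ⟨hc, hvc, hodd⟩

theorem oddLoop_reverseLoop [Nonempty V] {C : Perm V × Finset V} (h : (oddVertices C).Nonempty) :
    oddLoop (reverseLoop (oddLoop C) C) = (oddLoop C)⁻¹ := by
  obtain ⟨h₁, h₂, -⟩ := oddLoop_spec h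
  have hmem := inv_mem_cycleFactorsFinset_reverseLoop h₁
  refine (cycle_is_cycleOf ?_ hmem).symm
  rw [oddVertices_reverseLoop h₁]
  simpa using h₂

end LoopReversal

/-! ### The determinant formula for dicots -/

section DeterminantExpansion

open Equiv Equiv.Perm

variable {V : Type*} [Fintype V] [DecidableEq V]

/-- A permutation of a finite set that changes the colour of every point that it moves has only
cycles of even length. -/
theorem even_card_support_of_coloring {c : Perm V} {χ : V → Fin 2}
    (h : ∀ v ∈ c.support, χ v ≠ χ (c v)) : Even c.support.card := by
  have h0 : (c.support.filter fun v => χ v = 0).card =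
      (c.support.filter fun v => ¬ χ v = 0).card := by
    refine Finset.card_bij (fun v _ => c v) ?_ (fun u _ v _ e => c.injective e) ?_
    · intro v hv
      rw [Finset.mem_filter] at hv ⊢
      exact ⟨Perm.apply_mem_support.2 hv.1, fun e => h v hv.1 (hv.2.trans e.symm)⟩
    · intro v hv
      rw [Finset.mem_filter] at hv
      have hv' : c⁻¹ v ∈ c.support := inv_apply_mem_support.2 hv.1
      refine ⟨c⁻¹ v, Finset.mem_filter.2 ⟨hv', ?_⟩, apply_inv_apply c v⟩
      have h1 := h _ hv'
      rw [apply_inv_apply] at h1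
      omega
  rw [← Finset.card_filter_add_card_filter_not (s := c.support) (fun v => χ v = 0), h0]
  exact ⟨_, rfl⟩

theorem prod_cycleFactorsFinset_prod_support {M : Type*} [CommMonoid M] (σ : Perm V)
    (f : V → M) : ∏ c ∈ σ.cycleFactorsFinset, ∏ v ∈ c.support, f v = ∏ v ∈ σ.support, f v := by
  rw [← Finset.prod_biUnion]
  · congr 1
    ext v
    simp only [Finset.mem_biUnion]
    constructor
    · rintro ⟨c, hc, hv⟩
      exact mem_cycleFactorsFinset_support_le hc hv
    · intro hv
      exact ⟨σ.cycleOf v, cycleOf_mem_cycleFactorsFinset_iff.2 hv,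
        by simpa [mem_support_cycleOf_iff] using hv⟩
  · intro c hc d hd hcd
    exact (cycleFactorsFinset_pairwise_disjoint σ hc hd hcd).disjoint_support

namespace Dicot

variable (G : Dicot V)

open Classical in
/-- The signed weighted adjacency matrix of the solid edges. -/
def solidMatrix : Matrix V V ℂ :=
  Matrix.of fun u v => if G.solid.Adj u v then G.solidFactor u v else 0

open Classical in
/-- The weighted adjacency matrix of the dashed edges, times `i`. -/
def dashedMatrix : Matrix V V ℂ :=
  Matrix.of fun u v => if G.dashed.Adj u v then Complex.I * (G.dashedWeight u v : ℂ) else 0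

omit [Fintype V] [DecidableEq V] in
theorem solidMatrix_swap (u v : V) : G.solidMatrix v u = -G.solidMatrix u v := by
  by_cases h : G.solid.Adj u v
  · have hw := G.solidWeight_comm u v h
    rcases G.dir_xor u v h with ⟨h1, h2⟩ | ⟨h1, h2⟩ <;>
      simp [solidMatrix, solidFactor, h, h.symm, h1, h2, hw]
  · have h' : ¬ G.solid.Adj v u := fun e => h e.symm
    simp [solidMatrix, h, h']

omit [Fintype V] [DecidableEq V] in
theorem dashedMatrix_swap (u v : V) : G.dashedMatrix v u = G.dashedMatrix u v := by
  by_cases h : G.dashed.Adj u v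
  · simp [dashedMatrix, h, h.symm, G.dashedWeight_comm u v h]
  · have h' : ¬ G.dashed.Adj v u := fun e => h e.symm
    simp [dashedMatrix, h, h']

/-- The factor that a vertex `v` contributes to the term of `(σ, D)` in the expansion of the
determinant. -/
def stepFactor (C : Perm V × Finset V) (v : V) : ℂ :=
  if v ∈ C.2 then G.dashedMatrix v (C.1 v)
  else (Matrix.diagonal (fun v => (G.vertexWeight v : ℂ)) + G.solidMatrix) v (C.1 v)

/-- The term of `(σ, D)` in the expansion of the determinant. -/
def term (C : Perm V × Finset V) : ℂ :=
  ((sign C.1 : ℤ) : ℂ) * ∏ v, G.stepFactor C v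

theorem det_eq_sum_term :
    (Matrix.diagonal (fun v => (G.vertexWeight v : ℂ)) + G.solidMatrix + G.dashedMatrix).det =
      ∑ C, G.term C := by
  rw [← Matrix.det_transpose, Matrix.det_apply', Fintype.sum_prod_type]
  refine Finset.sum_congr rfl fun σ _ => ?_
  simp only [term, ← Finset.mul_sum]
  congr 1
  simp only [Matrix.transpose_apply]
  simp only [Matrix.add_apply (Matrix.diagonal _ + G.solidMatrix)]
  simp_rw [add_comm _ (G.dashedMatrix _ _)]
  rw [Fintype.prod_add]
  refine Finset.sum_congr rfl fun D _ => ?_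
  simp only [stepFactor]
  rw [← Finset.prod_mul_prod_compl D]
  congr 1
  · exact Finset.prod_congr rfl fun v hv => by simp [hv]
  · exact Finset.prod_congr rfl fun v hv => by simp [Finset.mem_compl.1 hv]

theorem steps_of_term_ne_zero {C : Perm V × Finset V} (h : G.term C ≠ 0) :
    (∀ v ∈ C.2, G.dashed.Adj v (C.1 v)) ∧
      ∀ v ∈ C.1.support, v ∉ C.2 → G.solid.Adj v (C.1 v) := by
  have h' : ∀ v, G.stepFactor C v ≠ 0 := fun v hv =>
    h (by rw [term, Finset.prod_eq_zero (Finset.mem_univ v) hv, mul_zero])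
  constructor
  · intro v hv
    by_contra hn
    exact h' v (by simp [stepFactor, hv, dashedMatrix, hn])
  · intro v hv hD
    by_contra hn
    have hne : v ≠ C.1 v := fun e => (mem_support.1 hv) e.symm
    exact h' v (by simp [stepFactor, hD, solidMatrix, hn, hne])

theorem even_length_of_term_ne_zero {C : Perm V × Finset V} (h : G.term C ≠ 0) {c : Perm V}
    (hc : c ∈ C.1.cycleFactorsFinset) : Even c.support.card := by
  obtain ⟨h1, h2⟩ := G.steps_of_term_ne_zero h
  obtain ⟨χ⟩ := G.bipartite
  refine even_card_support_of_coloring (χ := χ) fun v hv => χ.valid ?_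
  rw [(mem_cycleFactorsFinset_iff.1 hc).2 v hv, SimpleGraph.sup_adj]
  by_cases hD : v ∈ C.2
  · exact Or.inr (h1 v hD)
  · exact Or.inl (h2 v (mem_cycleFactorsFinset_support_le hc hv) hD)

/-- Reversing a loop changes the sign of the factor of each of its solid steps. -/
theorem stepFactor_reverseLoop {C : Perm V × Finset V} {c : Perm V}
    (hc : c ∈ C.1.cycleFactorsFinset) (v : V) :
    G.stepFactor (reverseLoop c C) (c v) =
      (if v ∈ c.support \ C.2 then -1 else 1) * G.stepFactor C v := by
  by_cases hv : v ∈ c.support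
  · have hcv : c v = C.1 v := (mem_cycleFactorsFinset_iff.1 hc).2 v hv
    by_cases hD : v ∈ C.2
    · simp only [stepFactor, apply_mem_reverseLoop_iff, hD, if_true, Finset.mem_sdiff,
        not_true, and_false, if_false, one_mul, reverseLoop_apply_of_mem hc hv]
      rw [dashedMatrix_swap, hcv]
    · have hne : c v ≠ v := mem_support.1 hv
      simp only [stepFactor, apply_mem_reverseLoop_iff, hD, if_false, Finset.mem_sdiff, hv,
        not_false_iff, and_true, if_true, reverseLoop_apply_of_mem hc hv, Matrix.add_apply,
        Matrix.diagonal_apply_ne _ hne, zero_add]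
      rw [solidMatrix_swap, ← hcv, Matrix.diagonal_apply_ne _ hne.symm, zero_add, neg_one_mul]
  · have hcv : c v = v := notMem_support.1 hv
    have hD := apply_mem_reverseLoop_iff c C v
    rw [hcv] at hD
    simp only [stepFactor, hcv, hD, reverseLoop_apply_of_notMem hv, Finset.mem_sdiff, hv,
      false_and, if_false, one_mul]

theorem term_reverseLoop {C : Perm V × Finset V} {c : Perm V}
    (hc : c ∈ C.1.cycleFactorsFinset) :
    G.term (reverseLoop c C) = (-1) ^ (c.support \ C.2).card * G.term C := by
  have hsign : sign (reverseLoop c C).1 = sign C.1 := by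
    simp [reverseLoop, mul_assoc]
  rw [term, hsign, ← Equiv.prod_comp c]
  simp only [G.stepFactor_reverseLoop hc, Finset.prod_mul_distrib, term]
  rw [Finset.prod_ite_mem, Finset.univ_inter, Finset.prod_const]
  ring

/-- The loops with an odd number of dashed steps cancel against their reversals. -/
theorem sum_term_oddVertices :
    ∑ C with (oddVertices C).Nonempty, G.term C = 0 := by
  rcases isEmpty_or_nonempty V with hV | hV
  · refine Finset.sum_eq_zero fun C hC => ?_
    obtain ⟨v, -⟩ := (Finset.mem_filter.1 hC).2
    exact hV.elim v
  have hcancel : ∀ C : Perm V × Finset V, (oddVertices C).Nonempty →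
      G.term C + G.term (reverseLoop (oddLoop C) C) = 0 := by
    intro C hC
    obtain ⟨h₁, -, h₃⟩ := oddLoop_spec hC
    rw [G.term_reverseLoop h₁]
    by_cases h0 : G.term C = 0
    · simp [h0]
    · have heven := G.even_length_of_term_ne_zero h0 h₁
      rw [← Finset.card_inter_add_card_sdiff _ C.2, Nat.even_add] at heven
      have hodd : Odd ((oddLoop C).support \ C.2).card := by
        rw [← Nat.not_even_iff_odd] at h₃ ⊢
        tauto
      rw [hodd.neg_one_pow]
      ring
  refine Finset.sum_involution (fun C _ => reverseLoop (oddLoop C) C) ?_ ?_ ?_ ?_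
  · exact fun C hC => hcancel C (Finset.mem_filter.1 hC).2
  · intro C hC h0 he
    have := hcancel C (Finset.mem_filter.1 hC).2
    rw [he] at this
    exact h0 (by simpa using this)
  · intro C hC
    have hC := (Finset.mem_filter.1 hC).2
    rw [Finset.mem_filter, oddVertices_reverseLoop (oddLoop_spec hC).1]
    exact ⟨Finset.mem_univ _, hC⟩
  · intro C hC
    rw [oddLoop_reverseLoop (Finset.mem_filter.1 hC).2, reverseLoop_reverseLoop]

/-- The minus sign in the weight of a loop is the sign of a cycle of even length. -/
theorem weight_eq_term {C : Perm V × Finset V} (hC : G.IsConfiguration C.1 C.2) :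
    G.weight C = G.term C := by
  have hsign : ((sign C.1 : ℤ) : ℂ) = ∏ c ∈ C.1.cycleFactorsFinset, (-1) := by
    rw [sign_of_cycleType', cycleType_def, Multiset.map_map]
    change ((∏ c ∈ C.1.cycleFactorsFinset, -(-1 : ℤˣ) ^ c.support.card : ℤˣ) : ℤ) = (_ : ℂ)
    rw [Finset.prod_congr rfl (g := fun _ => (-1 : ℤˣ)) fun c hc => by
      rw [(hC.even_length c hc).neg_one_pow]]
    simp
  have hloop : ∀ c ∈ C.1.cycleFactorsFinset,
      G.loopWeight c C.2 = -1 * ∏ v ∈ c.support, G.stepFactor C v := by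
    intro c hc
    rw [loopWeight, neg_one_mul]
    congr 1
    refine Finset.prod_congr rfl fun v hv => ?_
    have hcv : c v = C.1 v := (mem_cycleFactorsFinset_iff.1 hc).2 v hv
    have hne : v ≠ C.1 v := fun e => mem_support.1 hv (hcv.trans e.symm)
    by_cases hD : v ∈ C.2
    · simp [stepFactor, hD, hcv, dashedMatrix, hC.dashed_step v hD]
    · have := hC.solid_step v (mem_cycleFactorsFinset_support_le hc hv) hD
      simp [stepFactor, hD, hcv, solidMatrix, this, hne]
  rw [weight, term, hsign, Finset.prod_congr rfl hloop, Finset.prod_mul_distrib,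
    prod_cycleFactorsFinset_prod_support, mul_assoc,
    ← Finset.prod_mul_prod_compl C.1.support (G.stepFactor C)]
  congr 2
  refine Finset.prod_congr rfl fun v hv => ?_
  have hv : C.1 v = v := notMem_support.1 (Finset.mem_compl.1 hv)
  have hD : v ∉ C.2 := fun h => by simpa [hv] using hC.dashed_step v h
  simp [stepFactor, hD, hv, solidMatrix]

theorem mem_configurations {C : Perm V × Finset V} :
    C ∈ G.configurations ↔ G.IsConfiguration C.1 C.2 := by
  simp [configurations]

/-- The partition function of a dicot is a determinant. -/
theorem partitionFunction_eq_det : G.partitionFunction =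
    (Matrix.diagonal (fun v => (G.vertexWeight v : ℂ)) + G.solidMatrix + G.dashedMatrix).det := by
  rw [det_eq_sum_term, partitionFunction,
    ← Finset.sum_filter_add_sum_filter_not Finset.univ (fun C => (oddVertices C).Nonempty),
    sum_term_oddVertices, zero_add]
  refine (Finset.sum_congr rfl fun C hC => G.weight_eq_term ?_).trans
    (Finset.sum_subset ?_ ?_)
  · exact G.mem_configurations.1 hC
  · intro C hC
    have hC := G.mem_configurations.1 hC
    refine Finset.mem_filter.2 ⟨Finset.mem_univ _, ?_⟩
    rintro ⟨v, hv⟩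
    obtain ⟨c, hc, -, hodd⟩ := mem_oddVertices.1 hv
    exact Nat.not_even_iff_odd.2 hodd (hC.even_dashed c hc)
  · intro C hC hC'
    by_contra h0
    obtain ⟨h1, h2⟩ := G.steps_of_term_ne_zero h0
    refine hC' (G.mem_configurations.2 ⟨h1, h2,
      fun c hc => G.even_length_of_term_ne_zero h0 hc, fun c hc => ?_⟩)
    by_contra hodd
    obtain ⟨v, hv⟩ := (mem_cycleFactorsFinset_iff.1 hc).1.nonempty_support
    exact (Finset.mem_filter.1 hC).2
      ⟨v, mem_oddVertices.2 ⟨c, hc, hv, Nat.not_even_iff_odd.1 hodd⟩⟩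

end Dicot

end DeterminantExpansion

/-! ### The determinant of a quotient dicot -/

section BlockDeterminants

variable {ι : Type*} [Fintype ι] [DecidableEq ι]

/-- The matrix is similar to the block diagonal matrix with the blocks `A + C` and `A - C`. -/
theorem det_fromBlocks_I_smul (A C : Matrix ι ι ℂ) :
    (Matrix.fromBlocks A (Complex.I • C) (-Complex.I • C) A).det =
      (A + C).det * (A - C).det := by
  -- the columns of `T` diagonalize the matrix `[[0, i], [-i, 0]]`, with eigenvalues `1` and `-1`
  set T : Matrix (ι ⊕ ι) (ι ⊕ ι) ℂ :=
    Matrix.fromBlocks 1 1 (-Complex.I • 1) (Complex.I • 1) with hT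
  have hdet : T.det ≠ 0 := by
    rw [hT, Matrix.det_fromBlocks_one₁₁, Matrix.mul_one, ← sub_smul, Matrix.det_smul,
      Matrix.det_one, mul_one, sub_neg_eq_add, ← two_mul]
    exact pow_ne_zero _ (mul_ne_zero two_ne_zero Complex.I_ne_zero)
  have hmul : Matrix.fromBlocks A (Complex.I • C) (-Complex.I • C) A * T =
      T * Matrix.fromBlocks (A + C) 0 0 (A - C) := by
    rw [hT, Matrix.fromBlocks_multiply, Matrix.fromBlocks_multiply]
    congr 1 <;> ext u v <;> simp [← mul_assoc] <;> ring
  have h := congrArg Matrix.det hmul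
  rw [Matrix.det_mul, Matrix.det_mul, Matrix.det_fromBlocks_zero₂₁, mul_comm T.det] at h
  exact mul_right_cancel₀ hdet h

/-- Conjugation by a diagonal matrix of signs does not change the determinant. -/
theorem det_eq_of_gauge {M N : Matrix ι ι ℂ} (ε : ι → ℂ) (hε : ∀ u, ε u * ε u = 1)
    (h : ∀ u v, M u v = ε u * N u v * ε v) : M.det = N.det := by
  have hM : M = Matrix.diagonal ε * N * Matrix.diagonal ε := by
    ext u v
    rw [Matrix.mul_diagonal, Matrix.diagonal_mul, h]
  rw [hM, Matrix.det_mul, Matrix.det_mul, mul_right_comm, Matrix.det_diagonal,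
    ← Finset.prod_mul_distrib, Finset.prod_congr rfl fun u _ => hε u, Finset.prod_const_one,
    one_mul]

/-- Changing the signs of all dashed edges has the same effect as a transposition followed by a
change of all signs between the two colour classes. -/
theorem Dicot.det_sub_dashedMatrix (G : Dicot ι) (d : ι → ℂ) :
    (Matrix.diagonal d + G.solidMatrix - G.dashedMatrix).det =
      (Matrix.diagonal d + G.solidMatrix + G.dashedMatrix).det := by
  obtain ⟨χ⟩ := G.bipartite
  rw [← Matrix.det_transpose]
  refine det_eq_of_gauge (fun v => (-1) ^ (χ v : ℕ)) (fun u => by rw [← mul_pow]; simp) ?_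
  intro u v
  simp only [Matrix.transpose_apply, Matrix.sub_apply, Matrix.add_apply]
  rw [G.solidMatrix_swap, G.dashedMatrix_swap]
  have hsq : ∀ w, (-1 : ℂ) ^ (χ w : ℕ) * (-1) ^ (χ w : ℕ) = 1 := fun w => by
    rw [← mul_pow]; simp
  rcases eq_or_ne u v with rfl | huv
  · have hs : G.solidMatrix u u = 0 := by simp [Dicot.solidMatrix]
    have hd : G.dashedMatrix u u = 0 := by simp [Dicot.dashedMatrix]
    rw [hs, hd, mul_right_comm, hsq]
    ring
  rw [Matrix.diagonal_apply_ne _ huv, Matrix.diagonal_apply_ne _ huv.symm]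
  by_cases hadj : (G.solid ⊔ G.dashed).Adj u v
  · have hsign : (-1 : ℂ) ^ (χ u : ℕ) * (-1) ^ (χ v : ℕ) = -1 := by
      have hne := χ.valid hadj
      rw [← pow_add]
      have : (χ u : ℕ) + (χ v : ℕ) = 1 := by omega
      rw [this, pow_one]
    rw [mul_right_comm, hsign]
    ring
  · rw [SimpleGraph.sup_adj, not_or] at hadj
    simp [Dicot.solidMatrix, Dicot.dashedMatrix, hadj.1, hadj.2]

end BlockDeterminants

namespace WeightedGraph

variable {V : Type*} [Fintype V] [DecidableEq V] (G : WeightedGraph V) {π : Equiv.Perm V}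
  {P₁ P₂ : Finset V}

theorem IsAdapted.bijective_elim {G : WeightedGraph V} (hπ : G.IsFreeInvolution π)
    (hP : G.IsAdapted π P₁ P₂) :
    Function.Bijective (Sum.elim (fun v : P₁ => (v : V)) fun v : P₁ => π v) := by
  have hdisj : ∀ u ∈ P₁, ∀ v ∈ P₁, u ≠ π v := by
    rintro u hu v hv rfl
    exact Finset.disjoint_left.1 hP.disjoint hu ((hP.mem_iff v).1 hv)
  constructor
  · rintro (⟨u, hu⟩ | ⟨u, hu⟩) (⟨v, hv⟩ | ⟨v, hv⟩) h
    · simpa using h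
    · exact absurd h (hdisj u hu v hv)
    · exact absurd h.symm (hdisj v hv u hu)
    · simpa using h
  · intro v
    by_cases hv : v ∈ P₁
    · exact ⟨Sum.inl ⟨v, hv⟩, rfl⟩
    · have hv₂ : v ∈ P₂ := by
        have : v ∈ P₁ ∪ P₂ := hP.union_eq ▸ Finset.mem_univ v
        exact (Finset.mem_union.1 this).resolve_left hv
      exact ⟨Sum.inr ⟨π v, (hP.mem_iff _).2 (by rwa [hπ.involutive])⟩, hπ.involutive v⟩

/-- If all edges between `P₁` and `P₂` point to `P₁`, then the matrix of `G` consists, up to the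
identification of `P₂` with `P₁` by `π`, of the blocks `A, iC, -iC, A`, where `A + C` is the matrix
of the quotient dicot. -/
theorem det_toDicot_eq_sq (h : G.graph.IsBipartite) (hπ : G.IsFreeInvolution π)
    (hP : G.IsAdapted π P₁ P₂)
    (hbip : (G.quotientSolid P₁ ⊔ G.quotientDashed hπ hP).IsBipartite)
    (hdir : ∀ u ∈ P₁, ∀ v ∈ P₁, G.graph.Adj u (π v) → G.dir (π v) u) (t : ℂ) :
    (Matrix.diagonal (fun _ => t) + (G.toDicot h).solidMatrix).det =
      (Matrix.diagonal (fun _ => t) + (G.quotientDicot hπ hP hbip).solidMatrix +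
        (G.quotientDicot hπ hP hbip).dashedMatrix).det ^ 2 := by
  rw [sq]
  nth_rewrite 2 [← Dicot.det_sub_dashedMatrix]
  rw [← det_fromBlocks_I_smul,
    ← Matrix.det_submatrix_equiv_self (Equiv.ofBijective _ (hP.bijective_elim hπ))]
  have hacross : ∀ u v : P₁, (G.toDicot h).solidMatrix u (π v) =
      Complex.I * (G.quotientDicot hπ hP hbip).dashedMatrix u v := by
    intro u v
    by_cases hadj : G.graph.Adj u (π v)
    · have h1 := hdir u u.2 v v.2 hadj
      have h2 : ¬ G.dir u (π v) := by
        rcases G.dir_xor _ _ hadj with h | h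
        · exact absurd h1 h.2
        · exact h.2
      simp [Dicot.solidMatrix, Dicot.solidFactor, Dicot.dashedMatrix, toDicot, quotientDicot,
        quotientDashed, hadj, h2, ← mul_assoc]
    · simp [Dicot.solidMatrix, Dicot.dashedMatrix, toDicot, quotientDicot, quotientDashed, hadj]
  have hne : ∀ u v : P₁, (u : V) ≠ π v := fun u v e =>
    Finset.disjoint_left.1 hP.disjoint u.2 (e ▸ (hP.mem_iff v).1 v.2)
  have hinside : ∀ u v : P₁, (G.toDicot h).solidMatrix u v =
      (G.quotientDicot hπ hP hbip).solidMatrix u v := fun _ _ => rfl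
  congr 1
  ext (u | u) (v | v)
  · simpa [Matrix.diagonal_apply] using hinside u v
  · simpa [Matrix.diagonal_apply_ne _ (hne u v)] using hacross u v
  · have h1 := hacross v u
    have h2 := (G.toDicot h).solidMatrix_swap v (π u)
    rw [h1, Dicot.dashedMatrix_swap] at h2
    simpa [Matrix.diagonal_apply_ne _ (hne v u).symm] using h2
  · have hrot : (G.toDicot h).solidMatrix (π u) (π v) = (G.toDicot h).solidMatrix u v := by
      by_cases hadj : G.graph.Adj u v
      · have h1 := hP.dir_inside u u.2 v v.2 hadj
        by_cases hd : G.dir u v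
        · simp [Dicot.solidMatrix, Dicot.solidFactor, toDicot, hπ.adj_iff, hadj, hd, h1.1 hd,
            hπ.edgeWeight_eq u v hadj]
        · have hd' : ¬ G.dir (π u) (π v) := mt h1.2 hd
          simp [Dicot.solidMatrix, Dicot.solidFactor, toDicot, hπ.adj_iff, hadj, hd, hd',
            hπ.edgeWeight_eq u v hadj]
      · simp [Dicot.solidMatrix, toDicot, hπ.adj_iff, hadj]
    simpa [Matrix.diagonal_apply] using hrot.trans (hinside u v)

end WeightedGraph

/-! ### Spectral decomposition of oriented paths -/

section PathSpectrum

/-- The signed adjacency matrix of the path on `N` vertices in which the edge between `k` and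
`k + 1` points from `k` to `k + 1` or backwards according to the sign `g k * g (k + 1)`. -/
def pathMatrix (N : ℕ) (g : ℕ → ℂ) : Matrix (Fin N) (Fin N) ℂ :=
  Matrix.of fun k l =>
    (if (l : ℕ) + 1 = k + 2 then g k * g l else 0) - if (l : ℕ) + 1 = k then g k * g l else 0

/-- The `q`-th of the angles `(q + 1)π / (N + 1)`, where `q` counts from `0`. -/
def pathAngle (N q : ℕ) : ℝ := (q + 1) * Real.pi / (N + 1)

/-- The matrix whose columns are the eigenvectors of `pathMatrix N g`. -/
def sineMatrix (N : ℕ) (g : ℕ → ℂ) : Matrix (Fin N) (Fin N) ℂ :=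
  Matrix.of fun k q =>
    g k * (Complex.I ^ ((k : ℕ) + 1) * (Real.sin (((k : ℕ) + 1 : ℕ) * pathAngle N q) : ℝ))

/-- The eigenvalue of `pathMatrix N g` that belongs to the angle `pathAngle N q`. -/
def pathEigenvalue (N q : ℕ) : ℂ := 2 * Complex.I * (Real.cos (pathAngle N q) : ℝ)

/-- A sequence that vanishes at `0` and `N + 1` may be treated at the ends of the path as in its
interior. -/
theorem sum_fin_ite_succ_eq {N : ℕ} {w : ℕ → ℂ} (h0 : w 0 = 0) (hN : w (N + 1) = 0) {j : ℕ}
    (hj : j ≤ N + 1) : ∑ l : Fin N, (if (l : ℕ) + 1 = j then w (l + 1) else 0) = w j := by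
  rcases Nat.eq_zero_or_pos j with rfl | hpos
  · simp [h0]
  rcases hj.lt_or_eq with hlt | rfl
  · rw [Finset.sum_eq_single ⟨j - 1, by omega⟩]
    · simp [Nat.sub_add_cancel hpos]
    · intro l _ hl
      rw [if_neg]
      intro h
      exact hl (Fin.ext (by simp; omega))
    · simp
  · rw [hN]
    refine Finset.sum_eq_zero fun l _ => if_neg ?_
    have := l.2
    omega

theorem pathMatrix_mul_sineMatrix (N : ℕ) {g : ℕ → ℂ} (hg : ∀ k, g k * g k = 1) :
    pathMatrix N g * sineMatrix N g =
      sineMatrix N g * Matrix.diagonal fun q : Fin N => pathEigenvalue N q := by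
  ext k q
  rw [Matrix.mul_diagonal, Matrix.mul_apply]
  set φ := pathAngle N q with hφ
  set w : ℕ → ℂ := fun l => Complex.I ^ l * (Real.sin (l * φ) : ℝ) with hw
  have h0 : w 0 = 0 := by simp [hw]
  have hN : w (N + 1) = 0 := by
    have h : (((N + 1 : ℕ) : ℝ)) * φ = ((q : ℕ) + 1 : ℕ) * Real.pi := by
      rw [hφ, pathAngle]
      push_cast
      field_simp
    simp only [hw, h, Real.sin_nat_mul_pi, Complex.ofReal_zero, mul_zero]
  have hsum : ∑ l, pathMatrix N g k l * sineMatrix N g l q = g k * (w (k + 2) - w k) := by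
    rw [← sum_fin_ite_succ_eq h0 hN (show (k : ℕ) + 2 ≤ N + 1 by omega),
      ← sum_fin_ite_succ_eq h0 hN (show (k : ℕ) ≤ N + 1 by omega), ← Finset.sum_sub_distrib,
      Finset.mul_sum]
    refine Finset.sum_congr rfl fun l _ => ?_
    have hl : sineMatrix N g l q = g l * w (l + 1) := rfl
    have hgw : g k * g l * (g l * w (l + 1)) = g k * w (l + 1) := by
      rw [mul_assoc, ← mul_assoc (g l), hg, one_mul]
    rw [hl, pathMatrix, Matrix.of_apply, sub_mul, mul_sub, ite_mul, ite_mul, hgw, zero_mul,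
      mul_ite, mul_ite, mul_zero]
  have hsin : (Real.sin (((k : ℕ) + 2 : ℕ) * φ) : ℂ) + (Real.sin ((k : ℕ) * φ) : ℝ) =
      2 * (Real.cos φ : ℝ) * (Real.sin (((k : ℕ) + 1 : ℕ) * φ) : ℝ) := by
    have h1 : (((k : ℕ) + 2 : ℕ) : ℝ) * φ = ((k : ℕ) + 1 : ℕ) * φ + φ := by push_cast; ring
    have h2 : ((k : ℕ) : ℝ) * φ = ((k : ℕ) + 1 : ℕ) * φ - φ := by push_cast; ring
    rw [h1, h2, Real.sin_add, Real.sin_sub]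
    push_cast
    ring
  have hk : sineMatrix N g k q = g k * w (k + 1) := rfl
  rw [hsum, hk, pathEigenvalue, ← hφ, mul_assoc]
  congr 1
  simp only [hw, pow_add, pow_two, pow_one]
  linear_combination (-Complex.I ^ (k : ℕ)) * hsin +
    Complex.I ^ (k : ℕ) * ((Real.sin (((k : ℕ) + 2 : ℕ) * φ) : ℝ) -
      2 * (Real.cos φ : ℝ) * (Real.sin (((k : ℕ) + 1 : ℕ) * φ) : ℝ)) * Complex.I_mul_I

theorem pathAngle_rev {N : ℕ} (q : Fin N) :
    pathAngle N (Fin.rev q) = Real.pi - pathAngle N q := by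
  rw [pathAngle, pathAngle, Fin.val_rev, Nat.cast_sub (by omega)]
  push_cast
  field_simp
  ring

theorem pathEigenvalue_rev {N : ℕ} (q : Fin N) :
    pathEigenvalue N (Fin.rev q) = -pathEigenvalue N q := by
  rw [pathEigenvalue, pathAngle_rev, Real.cos_pi_sub, pathEigenvalue]
  push_cast
  ring

theorem pathAngle_mem_Ioo {N : ℕ} (q : Fin N) : pathAngle N q ∈ Set.Ioo 0 Real.pi := by
  have hq : ((q : ℕ) : ℝ) + 1 < N + 1 := by exact_mod_cast Nat.succ_lt_succ q.2
  have hN : (0 : ℝ) < N + 1 := by positivity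
  refine ⟨div_pos (by positivity) hN, ?_⟩
  rw [pathAngle, div_lt_iff₀ hN, mul_comm Real.pi]
  exact mul_lt_mul_of_pos_right hq Real.pi_pos

theorem pathEigenvalue_injective (N : ℕ) :
    Function.Injective fun q : Fin N => pathEigenvalue N q := by
  intro p q h
  have hcos : Real.cos (pathAngle N p) = Real.cos (pathAngle N q) := by
    have h2 : (2 * Complex.I : ℂ) ≠ 0 := mul_ne_zero two_ne_zero Complex.I_ne_zero
    exact_mod_cast mul_left_cancel₀ h2 h
  have hang := Real.injOn_cos (Set.Ioo_subset_Icc_self (pathAngle_mem_Ioo p))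
    (Set.Ioo_subset_Icc_self (pathAngle_mem_Ioo q)) hcos
  have hN : (N : ℝ) + 1 ≠ 0 := by positivity
  rw [pathAngle, pathAngle, div_left_inj' hN, mul_left_inj' Real.pi_ne_zero] at hang
  exact Fin.ext (by exact_mod_cast add_right_cancel hang)

/-- A matrix whose columns are eigenvectors for distinct eigenvalues is invertible. -/
theorem det_ne_zero_of_mul_eq_mul_diagonal {ι : Type*} [Fintype ι] [DecidableEq ι]
    {A W : Matrix ι ι ℂ} {μ : ι → ℂ} (h : A * W = W * Matrix.diagonal μ)
    (hμ : Function.Injective μ) (hW : ∀ q, ∃ k, W k q ≠ 0) : W.det ≠ 0 := by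
  have hvec : ∀ q, Module.End.HasEigenvector (Matrix.toLin' A) (μ q) (W.col q) := by
    intro q
    rw [Module.End.hasEigenvector_iff, Module.End.mem_eigenspace_iff]
    constructor
    · ext k
      have := congrFun (congrFun h k) q
      rw [Matrix.mul_diagonal, Matrix.mul_apply] at this
      simpa [Matrix.mulVec, dotProduct, mul_comm] using this
    · intro h0
      obtain ⟨k, hk⟩ := hW q
      exact hk (congrFun h0 k)
  have hind := Module.End.eigenvectors_linearIndependent' _ μ hμ _ hvec
  have hunit := Matrix.linearIndependent_cols_iff_isUnit.1 hind
  exact ((Matrix.isUnit_iff_isUnit_det _).1 hunit).ne_zero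

theorem det_sineMatrix_ne_zero (N : ℕ) {g : ℕ → ℂ} (hg : ∀ k, g k * g k = 1) :
    (sineMatrix N g).det ≠ 0 := by
  refine det_ne_zero_of_mul_eq_mul_diagonal (pathMatrix_mul_sineMatrix N hg)
    (pathEigenvalue_injective N) fun q => ⟨⟨0, q.pos⟩, ?_⟩
  have hsin := (Real.sin_pos_of_mem_Ioo (pathAngle_mem_Ioo q)).ne'
  have h0 : g 0 ≠ 0 := fun h => by simpa [h] using hg 0
  simpa [sineMatrix, h0, ← Complex.ofReal_sin] using hsin

/-- Alternating signs along the path reverse the order of the eigenvectors. -/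
theorem diagonal_mul_sineMatrix (N : ℕ) (g : ℕ → ℂ) :
    Matrix.diagonal (fun k : Fin N => (-1 : ℂ) ^ ((k : ℕ) + 1)) * sineMatrix N g =
      sineMatrix N g * -(1 : Matrix (Fin N) (Fin N) ℂ).submatrix id Fin.rev := by
  rw [Matrix.mul_neg]
  have h := Matrix.mul_submatrix_one (Equiv.refl (Fin N)) Fin.rev (sineMatrix N g)
  simp only [Equiv.coe_refl, Equiv.refl_symm, Function.id_comp] at h
  rw [h]
  ext k q
  rw [Matrix.diagonal_mul, Matrix.neg_apply, Matrix.submatrix_apply, sineMatrix, Matrix.of_apply,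
    Matrix.of_apply, id, pathAngle_rev, mul_sub, Real.sin_nat_mul_pi_sub]
  push_cast
  ring

end PathSpectrum

/-! ### The determinant of the grid -/

section GridDeterminant

open scoped Kronecker

/-- The numbers below `2 * n`, paired by `q ↔ 2 * n - 1 - q`. -/
def sumRevEquiv (n : ℕ) : Fin n ⊕ Fin n ≃ Fin (2 * n) :=
  ((Equiv.refl _).sumCongr Fin.revPerm).trans (finSumFinEquiv.trans (finCongr (two_mul n).symm))

theorem sumRevEquiv_inl {n : ℕ} (q : Fin n) : (sumRevEquiv n (Sum.inl q) : ℕ) = q := by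
  simp [sumRevEquiv]

theorem sumRevEquiv_inr {n : ℕ} (q : Fin n) :
    sumRevEquiv n (Sum.inr q) = Fin.rev (sumRevEquiv n (Sum.inl q)) := by
  ext
  simp [sumRevEquiv]
  omega

theorem det_fromBlocks_diagonal {ι R : Type*} [Fintype ι] [DecidableEq ι] [CommRing R]
    (α β γ δ : ι → R) :
    (Matrix.fromBlocks (Matrix.diagonal α) (Matrix.diagonal β) (Matrix.diagonal γ)
      (Matrix.diagonal δ)).det = ∏ i, (α i * δ i - β i * γ i) := by
  let e : ι ⊕ ι ≃ Fin 2 × ι :=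
    (Equiv.boolProdEquivSum ι).symm.trans (finTwoEquiv.symm.prodCongr (Equiv.refl ι))
  have h : Matrix.fromBlocks (Matrix.diagonal α) (Matrix.diagonal β) (Matrix.diagonal γ)
      (Matrix.diagonal δ) =
      (Matrix.blockDiagonal fun i => !![α i, β i; γ i, δ i]).submatrix e e := by
    ext (i | i) (j | j) <;> rcases eq_or_ne i j with rfl | hij <;>
      simp_all [e, Matrix.blockDiagonal_apply, finTwoEquiv]
  rw [h, Matrix.det_submatrix_equiv_self, Matrix.det_blockDiagonal]
  simp only [Matrix.det_fin_two_of]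

/-- As opposite eigenvalues are exchanged by the reversal, the matrix splits into the `2 × 2` blocks
`[[t + bμ, -s], [-s, t - bμ]]`. -/
theorem det_reverse_add_diagonal (n : ℕ) (t s b : ℂ) :
    (t • 1 + s • -(1 : Matrix (Fin (2 * n)) (Fin (2 * n)) ℂ).submatrix id Fin.rev +
      b • Matrix.diagonal fun q : Fin (2 * n) => pathEigenvalue (2 * n) q).det =
      ∏ q : Fin n, (t ^ 2 - s ^ 2 - (b * pathEigenvalue (2 * n) q) ^ 2) := by
  rw [← Matrix.det_submatrix_equiv_self (sumRevEquiv n)]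
  have h : (t • 1 + s • -(1 : Matrix (Fin (2 * n)) (Fin (2 * n)) ℂ).submatrix id Fin.rev +
      b • Matrix.diagonal fun q : Fin (2 * n) => pathEigenvalue (2 * n) q).submatrix
        (sumRevEquiv n) (sumRevEquiv n) =
      Matrix.fromBlocks (Matrix.diagonal fun q : Fin n => t + b * pathEigenvalue (2 * n) q)
        (Matrix.diagonal fun _ => -s) (Matrix.diagonal fun _ => -s)
        (Matrix.diagonal fun q : Fin n => t - b * pathEigenvalue (2 * n) q) := by
    have hne : ∀ i j : Fin n, sumRevEquiv n (Sum.inl i) ≠ Fin.rev (sumRevEquiv n (Sum.inl j)) :=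
      fun i j h => by
        rw [← sumRevEquiv_inr] at h
        simpa using (sumRevEquiv n).injective h
    have hne' : ∀ i j : Fin n, Fin.rev (sumRevEquiv n (Sum.inl i)) ≠ sumRevEquiv n (Sum.inl j) :=
      fun i j h => hne j i h.symm
    have hinj : ∀ i j : Fin n,
        sumRevEquiv n (Sum.inl i) = sumRevEquiv n (Sum.inl j) ↔ i = j := fun i j => by simp
    have hrev : ∀ i : Fin n, pathEigenvalue (2 * n) (Fin.rev (sumRevEquiv n (Sum.inl i))) =
        -pathEigenvalue (2 * n) i := fun i => by rw [pathEigenvalue_rev, sumRevEquiv_inl]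
    ext (i | i) (j | j) <;> rcases eq_or_ne i j with rfl | hij <;>
      simp_all [Matrix.one_apply, sumRevEquiv_inr, sumRevEquiv_inl, sub_eq_add_neg,
        -Fin.val_rev]
  rw [h, det_fromBlocks_diagonal]
  refine Finset.prod_congr rfl fun q _ => ?_
  ring

/-- Passing to the eigenvectors of both paths turns the matrix into a block diagonal one, with one
block for each eigenvalue of the first path. The alternating signs act on each block as the negative
of the reversal of the eigenvectors of the second path. -/
theorem det_kronecker_path (M n : ℕ) (t a b : ℂ) {g : ℕ → ℂ} (hg : ∀ k, g k * g k = 1) :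
    (t • 1 + a • (pathMatrix M 1 ⊗ₖ
        Matrix.diagonal fun k : Fin (2 * n) => (-1 : ℂ) ^ ((k : ℕ) + 1)) +
      b • ((1 : Matrix (Fin M) (Fin M) ℂ) ⊗ₖ pathMatrix (2 * n) g)).det =
      ∏ p : Fin M, ∏ q : Fin n,
        (t ^ 2 - (a * pathEigenvalue M p) ^ 2 - (b * pathEigenvalue (2 * n) q) ^ 2) := by
  set U := sineMatrix M 1
  set W := sineMatrix (2 * n) g
  set R := -(1 : Matrix (Fin (2 * n)) (Fin (2 * n)) ℂ).submatrix id Fin.rev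
  set L := t • 1 + a • ((Matrix.diagonal fun p : Fin M => pathEigenvalue M p) ⊗ₖ R) +
    b • ((1 : Matrix (Fin M) (Fin M) ℂ) ⊗ₖ
      Matrix.diagonal fun q : Fin (2 * n) => pathEigenvalue (2 * n) q) with hL
  have hg1 : ∀ k, (1 : ℕ → ℂ) k * (1 : ℕ → ℂ) k = 1 := fun k => by simp
  have hdet : (U ⊗ₖ W).det ≠ 0 := by
    rw [Matrix.det_kronecker]
    exact mul_ne_zero (pow_ne_zero _ (det_sineMatrix_ne_zero M hg1))
      (pow_ne_zero _ (det_sineMatrix_ne_zero (2 * n) hg))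
  have hmul : (t • 1 + a • (pathMatrix M 1 ⊗ₖ
        Matrix.diagonal fun k : Fin (2 * n) => (-1 : ℂ) ^ ((k : ℕ) + 1)) +
      b • ((1 : Matrix (Fin M) (Fin M) ℂ) ⊗ₖ pathMatrix (2 * n) g)) * (U ⊗ₖ W) =
      (U ⊗ₖ W) * L := by
    rw [hL, add_mul, add_mul, mul_add, mul_add, Matrix.smul_mul, Matrix.smul_mul,
      Matrix.smul_mul, Matrix.mul_smul, Matrix.mul_smul, Matrix.mul_smul,
      ← Matrix.mul_kronecker_mul, ← Matrix.mul_kronecker_mul, ← Matrix.mul_kronecker_mul,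
      ← Matrix.mul_kronecker_mul, pathMatrix_mul_sineMatrix M hg1,
      pathMatrix_mul_sineMatrix (2 * n) hg, diagonal_mul_sineMatrix]
    simp only [one_mul, mul_one, U, W, R]
  have hLdet : L.det = ∏ p : Fin M, (t • 1 + (a * pathEigenvalue M p) • R +
      b • Matrix.diagonal fun q : Fin (2 * n) => pathEigenvalue (2 * n) q).det := by
    rw [← Matrix.det_blockDiagonal,
      ← Matrix.det_submatrix_equiv_self (Equiv.prodComm (Fin M) (Fin (2 * n)))]
    congr 1
    ext ⟨p, q⟩ ⟨p', q'⟩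
    rcases eq_or_ne p p' with rfl | hp
    · simp [hL, Matrix.one_apply, mul_assoc]
    · simp [hL, Matrix.blockDiagonal_apply, hp]
  have h := congrArg Matrix.det hmul
  rw [Matrix.det_mul, Matrix.det_mul, mul_comm] at h
  rw [mul_left_cancel₀ hdet h, hLdet]
  exact Finset.prod_congr rfl fun p _ => det_reverse_add_diagonal n _ _ _

/-- The signs `g` with `g k * g (k + 1) = 1` for `k + 1 < n` and `g k * g (k + 1) = -1` for
`k + 1 ≥ n`, which encode the directions of the vertical edges of the grid. -/
def gridGauge (n k : ℕ) : ℂ := if k < n then 1 else (-1) ^ (k + n + 1)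

theorem gridGauge_mul_self (n k : ℕ) : gridGauge n k * gridGauge n k = 1 := by
  unfold gridGauge
  split_ifs
  · simp
  · rw [← mul_pow]; simp

theorem gridGauge_mul_succ (n k : ℕ) :
    gridGauge n k * gridGauge n (k + 1) = if k + 1 < n then 1 else -1 := by
  unfold gridGauge
  rcases lt_trichotomy (k + 1) n with h | h | h
  · simp [h, (Nat.lt_succ_self k).trans h]
  · subst h
    simp [← two_mul, pow_succ]
  · rw [if_neg (by omega), if_neg (by omega), if_neg (by omega), ← pow_add]
    exact Odd.neg_one_pow ⟨k + n + 1, by ring⟩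

variable (m n : ℕ) {x a b : ℝ} (hx : 0 < x) (ha : 0 < a) (hb : 0 < b)

theorem grid_solidMatrix :
    ((grid m n hx ha hb).toDicot (grid_bipartite m n hx ha hb)).solidMatrix =
      (a : ℂ) • (pathMatrix (2 * m) 1 ⊗ₖ
        Matrix.diagonal fun k : Fin (2 * n) => (-1 : ℂ) ^ ((k : ℕ) + 1)) +
      (b : ℂ) • ((1 : Matrix (Fin (2 * m)) (Fin (2 * m)) ℂ) ⊗ₖ
        pathMatrix (2 * n) (gridGauge n)) := by
  ext ⟨⟨p1, hp1⟩, ⟨p2, hp2⟩⟩ ⟨⟨q1, hq1⟩, ⟨q2, hq2⟩⟩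
  simp only [Dicot.solidMatrix, Dicot.solidFactor, WeightedGraph.toDicot, grid, gridDir,
    SimpleGraph.boxProd_adj, SimpleGraph.pathGraph_adj, Matrix.of_apply, Matrix.add_apply,
    Matrix.smul_apply, Matrix.kronecker_apply, pathMatrix, Matrix.diagonal_apply,
    Matrix.one_apply, Fin.mk.injEq, smul_eq_mul, Pi.one_apply, mul_one]
  have hss : ∀ k : ℕ, ¬ k + 1 + 1 = k := by omega
  by_cases h2 : p2 = q2
  · subst h2
    rcases Nat.even_or_odd (p2 + 1) with hp | hp
    all_goals
      have hp' := hp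
      first
        | rw [← Nat.not_odd_iff_even] at hp'
        | rw [← Nat.not_even_iff_odd] at hp'
      by_cases h3 : p1 + 1 = q1
      · subst h3
        simp [hp, hp', hp.neg_one_pow, hss]
      · by_cases h4 : q1 + 1 = p1
        · subst h4
          simp [hp, hp', hp.neg_one_pow, hss]
        · have h5 : ¬ q1 = p1 + 1 := by omega
          simp [h3, h4, h5]
  · by_cases h1 : p1 = q1
    · subst h1
      by_cases h3 : p2 + 1 = q2
      · subst h3
        by_cases h4 : p2 + 1 < n <;> simp [gridGauge_mul_succ, hss, h4]
      · by_cases h4 : q2 + 1 = p2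
        · subst h4
          rw [mul_comm (gridGauge n (q2 + 1))]
          by_cases h5 : q2 + 1 < n
          · have h6 : ¬ n ≤ q2 + 1 := by omega
            simp [gridGauge_mul_succ, hss, h5, h6]
          · have h6 : n ≤ q2 + 1 := by omega
            simp [gridGauge_mul_succ, hss, h5, h6]
        · have h5 : ¬ q2 = p2 + 1 := by omega
          simp [h2, h3, h4, h5]
    · simp [h1, h2]

theorem grid_det (t : ℂ) :
    (Matrix.diagonal (fun _ => t) +
      ((grid m n hx ha hb).toDicot (grid_bipartite m n hx ha hb)).solidMatrix).det =
      (∏ p : Fin m, ∏ q : Fin n, (t ^ 2 +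
        (4 * a ^ 2 * Real.cos (pathAngle (2 * m) p) ^ 2 +
          4 * b ^ 2 * Real.cos (pathAngle (2 * n) q) ^ 2 : ℝ))) ^ 2 := by
  have hd : (Matrix.diagonal fun _ : GridVertex m n => t) = t • 1 := by
    rw [Matrix.smul_one_eq_diagonal]
  rw [hd, grid_solidMatrix, ← add_assoc, det_kronecker_path _ _ _ _ _ (gridGauge_mul_self n),
    ← (sumRevEquiv m).prod_comp, Fintype.prod_sum_type, pow_two (∏ p : Fin m, _)]
  have hfactor : ∀ (p : Fin m) (q : Fin n),
      t ^ 2 - (a * pathEigenvalue (2 * m) p) ^ 2 - (b * pathEigenvalue (2 * n) q) ^ 2 =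
        t ^ 2 + (4 * a ^ 2 * Real.cos (pathAngle (2 * m) p) ^ 2 +
          4 * b ^ 2 * Real.cos (pathAngle (2 * n) q) ^ 2 : ℝ) := by
    intro p q
    simp only [pathEigenvalue, mul_pow, Complex.I_sq]
    push_cast
    ring
  congr 1 <;> refine Finset.prod_congr rfl fun p _ => Finset.prod_congr rfl fun q _ => ?_
  · rw [sumRevEquiv_inl, hfactor]
  · rw [sumRevEquiv_inr, pathEigenvalue_rev, sumRevEquiv_inl, mul_neg, neg_sq, hfactor]

end GridDeterminant

/-! ### The square root of the partition function of the grid -/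

section SquareRoot

open Polynomial in
/-- The determinant of `t + N` and the product of the factors `t² + c i`, as polynomials in `t`, are
monic. If their squares agree, they are equal up to sign, and the sign is determined by the leading
coefficients. -/
theorem det_diagonal_add_eq_prod {ι κ : Type*} [Fintype ι] [DecidableEq ι] [Fintype κ]
    (N : Matrix ι ι ℂ) (c : κ → ℂ)
    (h : ∀ t : ℂ, (Matrix.diagonal (fun _ => t) + N).det ^ 2 = (∏ i, (t ^ 2 + c i)) ^ 2) (t : ℂ) :
    (Matrix.diagonal (fun _ => t) + N).det = ∏ i, (t ^ 2 + c i) := by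
  have hQ : (∏ i, (X ^ 2 + C (c i))).Monic :=
    monic_prod_of_monic _ _ fun i _ => monic_X_pow_add_C _ two_ne_zero
  have hPe : ∀ t, (-N).charpoly.eval t = (Matrix.diagonal (fun _ => t) + N).det := fun t => by
    rw [Matrix.eval_charpoly, sub_neg_eq_add, Matrix.scalar_apply]
  have hQe : ∀ t, (∏ i, (X ^ 2 + C (c i))).eval t = ∏ i, (t ^ 2 + c i) := fun t => by
    simp [eval_prod]
  have hsq : (-N).charpoly ^ 2 = (∏ i, (X ^ 2 + C (c i))) ^ 2 :=
    Polynomial.funext fun t => by rw [eval_pow, eval_pow, hPe, hQe, h]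
  have heq : (-N).charpoly = ∏ i, (X ^ 2 + C (c i)) := by
    rcases sq_eq_sq_iff_eq_or_eq_neg.1 hsq with h1 | h1
    · exact h1
    · have h2 := congrArg leadingCoeff h1
      rw [leadingCoeff_neg, (Matrix.charpoly_monic _).leadingCoeff, hQ.leadingCoeff] at h2
      norm_num at h2
  rw [← hPe, heq, hQe]

variable (m n : ℕ) {x a b : ℝ} (hx : 0 < x) (ha : 0 < a) (hb : 0 < b)

theorem grid_dir_across : ∀ u ∈ gridLower m n, ∀ v ∈ gridLower m n,
    (grid m n hx ha hb).graph.Adj u (gridRotation m n v) →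
      (grid m n hx ha hb).dir (gridRotation m n v) u := by
  rintro ⟨⟨p1, hp1⟩, ⟨p2, hp2⟩⟩ hu ⟨⟨q1, hq1⟩, ⟨q2, hq2⟩⟩ hv h
  simp only [gridLower, Finset.mem_filter, Finset.mem_univ, true_and] at hu hv
  simp only [grid, gridRotation, Equiv.prodCongr_apply, Prod.map, Fin.revPerm_apply,
    SimpleGraph.boxProd_adj, SimpleGraph.pathGraph_adj, Fin.val_rev, Fin.ext_iff] at h
  simp only [grid, gridDir, gridRotation, Equiv.prodCongr_apply, Prod.map, Fin.revPerm_apply,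
    Fin.val_rev, Fin.ext_iff]
  exact Or.inr ⟨by omega, Or.inr ⟨by omega, by omega⟩⟩

theorem gridQuotient_det_sq (t : ℂ) :
    (Matrix.diagonal (fun _ => t) +
      ((grid m n hx ha hb).toDicot (grid_bipartite m n hx ha hb)).solidMatrix).det =
    (Matrix.diagonal (fun _ => t) + ((gridQuotient m n hx ha hb).solidMatrix +
      (gridQuotient m n hx ha hb).dashedMatrix)).det ^ 2 := by
  rw [← add_assoc]
  exact WeightedGraph.det_toDicot_eq_sq _ _ _ _ _ (grid_dir_across m n hx ha hb) t

theorem gridQuotient_partitionFunction_eq_det : (gridQuotient m n hx ha hb).partitionFunction =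
    (Matrix.diagonal (fun _ => (x : ℂ)) + ((gridQuotient m n hx ha hb).solidMatrix +
      (gridQuotient m n hx ha hb).dashedMatrix)).det := by
  rw [Dicot.partitionFunction_eq_det, add_assoc]
  rfl

theorem grid_partitionFunction_eq_det :
    (grid m n hx ha hb).partitionFunction (grid_bipartite m n hx ha hb) =
      (Matrix.diagonal (fun _ => (x : ℂ)) +
        ((grid m n hx ha hb).toDicot (grid_bipartite m n hx ha hb)).solidMatrix).det := by
  have hd : ((grid m n hx ha hb).toDicot (grid_bipartite m n hx ha hb)).dashedMatrix = 0 := by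
    ext u v
    simp [Dicot.dashedMatrix, WeightedGraph.toDicot]
  rw [WeightedGraph.partitionFunction, Dicot.partitionFunction_eq_det, hd, add_zero]
  rfl

theorem gridQuotient_det (t : ℂ) :
    (Matrix.diagonal (fun _ => t) + ((gridQuotient m n hx ha hb).solidMatrix +
      (gridQuotient m n hx ha hb).dashedMatrix)).det =
    ∏ i : Fin m × Fin n, (t ^ 2 + (4 * a ^ 2 * Real.cos (pathAngle (2 * m) i.1) ^ 2 +
      4 * b ^ 2 * Real.cos (pathAngle (2 * n) i.2) ^ 2 : ℝ)) := by
  refine det_diagonal_add_eq_prod _ _ (fun t => ?_) t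
  rw [← gridQuotient_det_sq, grid_det, Fintype.prod_prod_type]

end SquareRoot

end MonopoleDimer

end

theorem mainTheorem5 (m n : ℕ) (x a b : ℝ) (hx : 0 < x) (ha : 0 < a) (hb : 0 < b) :
    (MonopoleDimer.gridQuotient m n hx ha hb).partitionFunction =
        ((∏ j ∈ Finset.Icc 1 m, ∏ k ∈ Finset.Icc 1 n,
          (x ^ 2 + 4 * a ^ 2 * Real.cos ((j : ℝ) * Real.pi / (2 * (m : ℝ) + 1)) ^ 2 +
            4 * b ^ 2 * Real.cos ((k : ℝ) * Real.pi / (2 * (n : ℝ) + 1)) ^ 2) : ℝ) : ℂ) ∧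
      (MonopoleDimer.grid m n hx ha hb).partitionFunction
          (MonopoleDimer.grid_bipartite m n hx ha hb) =
        (MonopoleDimer.gridQuotient m n hx ha hb).partitionFunction ^ 2 := by
  have hIcc : ∀ (N : ℕ) (f : ℕ → ℝ), ∏ j ∈ Finset.Icc 1 N, f j = ∏ j : Fin N, f (j + 1) := by
    intro N f
    rw [Fin.prod_univ_eq_prod_range (fun j => f (j + 1)), Finset.range_eq_Ico,
      Finset.prod_Ico_add']
    rfl
  constructor
  · rw [MonopoleDimer.gridQuotient_partitionFunction_eq_det, MonopoleDimer.gridQuotient_det,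
      Fintype.prod_prod_type, hIcc, Complex.ofReal_prod]
    refine Finset.prod_congr rfl fun p _ => ?_
    rw [hIcc, Complex.ofReal_prod]
    refine Finset.prod_congr rfl fun q _ => ?_
    simp only [MonopoleDimer.pathAngle]
    push_cast
    ring
  · rw [MonopoleDimer.grid_partitionFunction_eq_det, MonopoleDimer.gridQuotient_det_sq,
      MonopoleDimer.gridQuotient_partitionFunction_eq_det]
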